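/- All rings are commutative with identity. For a ring $R$, an ideal $E$ of $R$ is called essential if $E\neq(0)$ and $E\cap J\neq(0)$ for every non-zero ideal $J$ of $R$. The essential annihilating-ideal graph $\mathcal{EG}(R)$ is the simple graph whose vertices are the non-zero ideals of $R$ with non-zero annihilator, two distinct vertices $I,J$ being adjacent if and only if $\mathrm{Ann}(IJ)$ is an essential ideal of $R$. A graph $G$ is Class $1$ if its edge chromatic number $\chi'(G)$ (the least number of colours in a colouring of the edges in which any two distinct edges with a common end have different colours) equals its maximum degree $\Delta(G)$. Theorem. Let $t\geq 2$ be an even integer. Then there is a natural number $N$, depending only on $t$, such that for every integer $n\geq N$ with $n\geq 2$ and all Artinian local rings $R_1,\ldots,R_n$, each having exactly $t$ proper ideals (that is, ideals different from the whole ring, the zero ideal included), the graph $\mathcal{EG}(R_1\times\cdots\times R_n)$ is Class $1$. -/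

import Mathlib

namespace EssentialAnnihilatingIdealGraph

/-- An ideal is essential if it is non-zero and meets every non-zero ideal non-trivially. -/
def IsEssential {R : Type*} [CommRing R] (I : Ideal R) : Prop :=
  I ≠ ⊥ ∧ ∀ J : Ideal R, J ≠ ⊥ → I ⊓ J ≠ ⊥

/-- The vertices of the graph: the non-zero ideals with non-zero annihilator. -/
abbrev Vertex (R : Type*) [CommRing R] : Type _ :=
  {I : Ideal R // I ≠ ⊥ ∧ Submodule.annihilator I ≠ ⊥}

/-- The essential annihilating-ideal graph of a commutative ring: two distinct vertices `I`, `J`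
are adjacent if and only if the annihilator of the product `I * J` is an essential ideal. -/
def essAnnGraph (R : Type*) [CommRing R] : SimpleGraph (Vertex R) where
  Adj I J := I ≠ J ∧ IsEssential (Submodule.annihilator (I.1 * J.1))
  symm := ⟨fun I J h => ⟨h.1.symm, by rw [mul_comm]; exact h.2⟩⟩
  loopless := ⟨fun _ h => h.1 rfl⟩

/-- The edge chromatic number: the least number of colours in a colouring of the edges that
gives distinct edges with a common end different colours (`⊤` if no finite number suffices). -/
noncomputable def edgeChromaticNumber {V : Type*} (G : SimpleGraph V) : ℕ∞ :=
  G.lineGraph.chromaticNumber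

/-- The maximum degree, as an extended natural number. -/
noncomputable def maxDegree {V : Type*} (G : SimpleGraph V) : ℕ∞ :=
  ⨆ v : V, (G.neighborSet v).encard

/-- A graph is Class 1 if its edge chromatic number equals its maximum degree. -/
def IsClassOne {V : Type*} (G : SimpleGraph V) : Prop :=
  edgeChromaticNumber G = maxDegree G

end EssentialAnnihilatingIdealGraph

/-! An ideal of the product is a tuple of ideals. The annihilator of K is essential exactly when K
is nilpotent, that is, when no component of K is a whole ring (`isEssential_annihilator_iff`). So
adjacency means disjointness of full supports, and the vertices are all ideals except ⊥ and ⊤,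
(t+1)^n - 2 in number. The nonzero nilpotent ideals form a set U of universal vertices, whence Δ =
|V| - 1.

It remains to colour the edges with |V| - 1 colours (`isClassOne_of_universal`). Edges meeting U get
an explicit colouring by residues. All others are added greedily, which works for an edge whose ends
have degree sum at most |V| among the edges present. Let B consist of the ideals with at most k full
components. Edges inside B come next: B is at most half of V for large n. Any other edge has an end
outside B, whose degree is so small that the two degrees add up to at most |V|. -/

namespace EssentialAnnihilatingIdealGraph

/-! ### Greedy edge colouring -/

/-- `c` colours the edges in `X` with colours below `k`, distinct edges with a common end getting
distinct colours. -/
def IsProperOn {V : Type*} (X : Finset (Sym2 V)) (k : ℕ) (c : Sym2 V → ℕ) : Prop :=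
  (∀ e ∈ X, c e < k) ∧
    ∀ v, ∀ e ∈ X, ∀ f ∈ X, v ∈ e → v ∈ f → e ≠ f → c e ≠ c f

open Classical in
/-- Greedy colouring of one further edge. -/
theorem IsProperOn.exists_insert {V : Type*} {X : Finset (Sym2 V)} {k : ℕ} {c : Sym2 V → ℕ}
    (hc : IsProperOn X k c) {a b : V}
    (hab : (X.filter (a ∈ ·)).card + (X.filter (b ∈ ·)).card < k) :
    ∃ c', IsProperOn (insert s(a, b) X) k c' := by
  by_cases hmem : s(a, b) ∈ X
  · exact ⟨c, by rwa [Finset.insert_eq_of_mem hmem]⟩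
  obtain ⟨m, hmk, hm⟩ : ∃ m ∈ Finset.range k,
      m ∉ (X.filter (a ∈ ·) ∪ X.filter (b ∈ ·)).image c := by
    apply Finset.exists_mem_notMem_of_card_lt_card
    rw [Finset.card_range]
    exact (Finset.card_image_le.trans (Finset.card_union_le _ _)).trans_lt hab
  have hfree : ∀ v ∈ s(a, b), ∀ f ∈ X, v ∈ f → m ≠ c f := by
    rintro v hv f hf hvf rfl
    apply hm
    apply Finset.mem_image_of_mem
    rcases Sym2.mem_iff.1 hv with rfl | rfl <;> simp [hf, hvf]
  have hne : ∀ e ∈ X, e ≠ s(a, b) := fun e he h => hmem (h ▸ he)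
  refine ⟨Function.update c s(a, b) m, ?_, ?_⟩
  · intro e he
    rcases Finset.mem_insert.1 he with rfl | he
    · simpa using hmk
    · simpa [hne e he] using hc.1 e he
  · intro v e he f hf hve hvf hef
    rcases Finset.mem_insert.1 he with rfl | he <;> rcases Finset.mem_insert.1 hf with rfl | hf
    · exact absurd rfl hef
    · simpa [hne f hf] using hfree v hve f hf hvf
    · simpa [hne e he] using (hfree v hvf e he hve).symm
    · simpa [hne e he, hne f hf] using hc.2 v e he f hf hve hvf hef

open Classical in
/-- Greedy extension of a proper edge colouring from `X` to a larger set `Y` of edges. -/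
theorem IsProperOn.exists_extension {V : Type*} {X Y : Finset (Sym2 V)} {k : ℕ}
    {c : Sym2 V → ℕ} (hc : IsProperOn X k c) (hXY : X ⊆ Y)
    (hdeg : ∀ a b, s(a, b) ∈ Y → s(a, b) ∉ X →
      (Y.filter (a ∈ ·)).card + (Y.filter (b ∈ ·)).card ≤ k + 1) :
    ∃ c', IsProperOn Y k c' := by
  have key : ∀ D : Finset (Sym2 V), D ⊆ Y \ X → ∃ c', IsProperOn (X ∪ D) k c' := by
    intro D
    induction D using Finset.induction_on with
    | empty => exact fun _ => ⟨c, by simpa using hc⟩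
    | insert e D he ih =>
      intro hD
      rw [Finset.insert_subset_iff] at hD
      obtain ⟨c', hc'⟩ := ih hD.2
      induction e using Sym2.inductionOn with
      | hf a b =>
      rw [Finset.union_insert]
      have heY := Finset.mem_sdiff.1 hD.1
      have hlt : ∀ v ∈ s(a, b),
          ((X ∪ D).filter (v ∈ ·)).card < (Y.filter (v ∈ ·)).card := by
        intro v hv
        apply Finset.card_lt_card
        rw [Finset.ssubset_iff_of_subset]
        · exact ⟨s(a, b), by simp [heY.1, Sym2.mem_iff.1 hv], by simp [heY.2, he]⟩
        · exact Finset.filter_subset_filter _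
            (Finset.union_subset hXY (hD.2.trans Finset.sdiff_subset))
      -- The new edge is counted in `Y` at both ends but is not yet coloured, so at most k + 1 - 2
      -- colours are blocked.
      apply hc'.exists_insert
      have := hlt a (by simp)
      have := hlt b (by simp)
      have := hdeg a b heY.1 heY.2
      omega
  obtain ⟨c', hc'⟩ := key (Y \ X) subset_rfl
  exact ⟨c', by rwa [Finset.union_sdiff_of_subset hXY] at hc'⟩

/-! ### Explicit colouring of the edges meeting a small set -/

/-- The colour of the edge between the vertices numbered `a` and `b` in the join of a complete
graph on the numbers below `p` with an empty graph on the `q` numbers from `p` on. -/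
def joinColor (p q a b : ℕ) : ℕ :=
  if a < p ∧ b < p then (a + b) % p
  else if (a + b) % q = 0 then (2 * min a b) % p else p + ((a + b) % q - 1)

theorem joinColor_comm (p q a b : ℕ) : joinColor p q a b = joinColor p q b a := by
  simp only [joinColor, add_comm a b, min_comm a b, and_comm]

theorem joinColor_lt {p q : ℕ} (hp : 0 < p) (hpq : p ≤ q) (a b : ℕ) :
    joinColor p q a b < p + q - 1 := by
  have h1 := Nat.mod_lt (a + b) hp
  have h2 := Nat.mod_lt (a + b) (hp.trans_le hpq)
  have h3 := Nat.mod_lt (2 * min a b) hp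
  unfold joinColor
  split_ifs <;> omega

theorem add_mod_ne {m a b c : ℕ} (hbc : b < c) (hcb : c < b + m) :
    (a + b) % m ≠ (a + c) % m := by
  intro h
  have h' : b ≡ c [MOD m] := Nat.ModEq.add_left_cancel' a h
  have := Nat.le_of_dvd (by omega) ((Nat.modEq_iff_dvd' hbc.le).1 h')
  omega

/-- On the clique, a + b mod p leaves the colour 2a mod p free at a, since that would belong to the
missing loop at a. The cross edge at a with residue 0 mod q takes this free colour, which saves one
colour. A vertex outside the clique has at most one such edge because p ≤ q, so no clash arises
there. -/
theorem joinColor_ne {p q a b c : ℕ} (hp : 0 < p) (hpq : p ≤ q)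
    (hb : b < p + q) (hc : c < p + q) (hab : a ≠ b) (hac : a ≠ c)
    (hbc : b ≠ c) (h1 : a < p ∨ b < p) (h2 : a < p ∨ c < p) :
    joinColor p q a b ≠ joinColor p q a c := by
  wlog hlt : b < c generalizing b c
  · exact (this hc hb hac hab hbc.symm h2 h1 (by omega)).symm
  have hmp := Nat.mod_lt (a + b) hp
  have hmin := Nat.mod_lt (2 * min a b) hp
  have hmin' := Nat.mod_lt (2 * min a c) hp
  by_cases hap : a < p
  · by_cases hbp : b < p
    · by_cases hcp : c < p
      · simpa [joinColor, hap, hbp, hcp] using add_mod_ne hlt (by omega)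
      · have h3 : (a + b) % p ≠ (a + a) % p := by
          rcases Nat.lt_or_gt_of_ne hab with h | h
          · exact (add_mod_ne h (by omega)).symm
          · exact add_mod_ne h (by omega)
        have h4 : min a c = a := by omega
        simp only [joinColor, hap, hbp, hcp, and_self, and_false, if_true, if_false, h4, two_mul]
        split_ifs <;> omega
    · have hcp : ¬ c < p := by omega
      have h3 : (a + b) % q ≠ (a + c) % q := add_mod_ne hlt (by omega)
      simp only [joinColor, hbp, hcp, and_false, if_false]
      split_ifs <;> omega
  · have h3 : (a + b) % q ≠ (a + c) % q := add_mod_ne hlt (by omega)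
    simp only [joinColor, hap, false_and, if_false]
    split_ifs <;> omega

open Classical in
/-- The edges meeting a small set `U` can be properly coloured with one colour less than there
are vertices. -/
theorem exists_isProperOn_incident {V : Type*} [Fintype V] (G : SimpleGraph V) (U : Finset V)
    (hU : U.Nonempty) (hcard : 2 * U.card ≤ Fintype.card V) :
    ∃ c, IsProperOn (G.edgeFinset.filter fun e => ∃ u ∈ U, u ∈ e) (Fintype.card V - 1) c := by
  set p := U.card with hp
  set q := Uᶜ.card with hq
  have hsum : p + q = Fintype.card V := by rw [hp, hq, Finset.card_add_card_compl]
  have hp0 : 0 < p := hU.card_pos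
  obtain ⟨idx, hinj, hlt, hmem⟩ : ∃ idx : V → ℕ, idx.Injective ∧ (∀ v, idx v < p + q) ∧
      ∀ v, idx v < p ↔ v ∈ U := by
    let φ : V → ℕ := fun v => if h : v ∈ U then (U.equivFin ⟨v, h⟩ : ℕ) else
      p + (Uᶜ.equivFin ⟨v, Finset.mem_compl.2 h⟩ : ℕ)
    have h1 : ∀ v (h : v ∈ U), φ v = (U.equivFin ⟨v, h⟩ : ℕ) := fun v h => dif_pos h
    have h2 : ∀ v (h : v ∉ U), φ v = p + (Uᶜ.equivFin ⟨v, Finset.mem_compl.2 h⟩ : ℕ) :=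
      fun v h => dif_neg h
    have h3 : ∀ v, φ v < p ↔ v ∈ U := by
      intro v
      by_cases h : v ∈ U
      · simp only [h1 v h, h, iff_true]; exact (U.equivFin ⟨v, h⟩).2
      · simp [h2 v h, h]
    refine ⟨φ, ?_, ?_, h3⟩
    · intro v w hvw
      by_cases h : v ∈ U
      · have h' : w ∈ U := (h3 w).1 (hvw ▸ (h3 v).2 h)
        rw [h1 v h, h1 w h'] at hvw
        simpa using U.equivFin.injective (Fin.ext hvw)
      · have h' : w ∉ U := fun hw => h ((h3 v).1 (hvw ▸ (h3 w).2 hw))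
        rw [h2 v h, h2 w h'] at hvw
        simpa using Uᶜ.equivFin.injective (Fin.ext (Nat.add_left_cancel hvw))
    · intro v
      by_cases h : v ∈ U
      · have := (h3 v).2 h; omega
      · rw [h2 v h]; exact Nat.add_lt_add_left (Uᶜ.equivFin ⟨v, _⟩).2 p
  refine ⟨Sym2.lift ⟨fun a b => joinColor p q (idx a) (idx b), fun a b => joinColor_comm _ _ _ _⟩,
    ?_, ?_⟩
  · intro e _
    induction e using Sym2.inductionOn with
    | hf a b =>
    rw [← hsum]
    exact joinColor_lt hp0 (by omega) _ _
  · intro v e he f hf hve hvf hef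
    obtain ⟨x, rfl⟩ := Sym2.mem_iff_exists.1 hve
    obtain ⟨y, rfl⟩ := Sym2.mem_iff_exists.1 hvf
    have hxy : x ≠ y := by rintro rfl; exact hef rfl
    simp only [Finset.mem_filter, SimpleGraph.mem_edgeFinset, SimpleGraph.mem_edgeSet,
      Sym2.mem_iff] at he hf
    have hU' : ∀ {x}, (∃ u ∈ U, u = v ∨ u = x) → idx v < p ∨ idx x < p := by
      rintro x ⟨u, hu, rfl | rfl⟩
      · exact Or.inl ((hmem _).2 hu)
      · exact Or.inr ((hmem _).2 hu)
    exact joinColor_ne hp0 (by omega) (hlt x) (hlt y) (hinj.ne he.1.ne) (hinj.ne hf.1.ne)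
      (hinj.ne hxy) (hU' he.2) (hU' hf.2)

/-! ### A criterion for Class 1 -/

/-- The edges at a vertex need pairwise distinct colours. -/
theorem encard_neighborSet_le_edgeChromaticNumber {V : Type*} [Finite V] (G : SimpleGraph V)
    (v : V) : (G.neighborSet v).encard ≤ edgeChromaticNumber G := by
  classical
  have := Fintype.ofFinite V
  let s : Finset G.edgeSet := (G.neighborFinset v).attach.image fun w =>
    ⟨s(v, w.1), G.mem_edgeSet.2 ((G.mem_neighborFinset v w.1).1 w.2)⟩
  have hs : G.lineGraph.IsClique s := by
    intro e he f hf hef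
    rw [SimpleGraph.lineGraph_adj_iff_exists]
    refine ⟨hef, v, ?_⟩
    simp only [s, Finset.coe_image, Set.mem_image] at he hf
    obtain ⟨a, -, rfl⟩ := he
    obtain ⟨b, -, rfl⟩ := hf
    simp
  have hcard : s.card = (G.neighborFinset v).card := by
    rw [Finset.card_image_of_injective, Finset.card_attach]
    intro a b h
    exact Subtype.ext (Sym2.congr_right.1 (congrArg Subtype.val h))
  have := hs.card_le_chromaticNumber
  rw [hcard] at this
  rwa [← SimpleGraph.coe_neighborFinset, Set.encard_coe_eq_coe_finsetCard]

open Classical in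
theorem card_filter_mem_edgeFinset {V : Type*} [Fintype V] (G : SimpleGraph V) (P : V → Prop)
    [DecidablePred P] (v : V) (Y : Finset (Sym2 V)) (hY : Y ⊆ G.edgeFinset) (hP : ∀ w, s(v, w) ∈ Y → P w) :
    (Y.filter (v ∈ ·)).card ≤ ((G.neighborFinset v).filter P).card := by
  have : Y.filter (v ∈ ·) ⊆ ((G.neighborFinset v).filter P).image fun w => s(v, w) := by
    intro e he
    obtain ⟨heY, hve⟩ := Finset.mem_filter.1 he
    obtain ⟨w, rfl⟩ := Sym2.mem_iff_exists.1 hve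
    have := hY heY
    simp only [SimpleGraph.mem_edgeFinset, SimpleGraph.mem_edgeSet] at this
    exact Finset.mem_image.2 ⟨w, by simp [this, hP w heY], rfl⟩
  exact (Finset.card_le_card this).trans Finset.card_image_le

open Classical in
/-- A sufficient condition for a graph with a non-empty set `U` of universal vertices to be
Class 1: the vertices which are not in a small set `B` containing `U` have small degree. -/
theorem isClassOne_of_universal {V : Type*} [Fintype V] (G : SimpleGraph V) (U B : Finset V)
    (hUB : U ⊆ B) (hU : U.Nonempty) (huniv : ∀ u ∈ U, ∀ v, u ≠ v → G.Adj u v)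
    (hB : 2 * B.card ≤ Fintype.card V)
    (hdeg : ∀ a b, G.Adj a b → a ∉ U → b ∉ U → ¬ (a ∈ B ∧ b ∈ B) →
      G.degree a + G.degree b ≤ Fintype.card V) :
    IsClassOne G := by
  have hmax : maxDegree G = (Fintype.card V - 1 : ℕ) := by
    have hcompl : ∀ v : V, ({v}ᶜ : Set V).encard = (Fintype.card V - 1 : ℕ) := by
      intro v
      have : ({v}ᶜ : Set V) = (({v}ᶜ : Finset V) : Set V) := by simp
      rw [this, Set.encard_coe_eq_coe_finsetCard, Finset.card_compl, Finset.card_singleton]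
    apply le_antisymm
    · refine iSup_le fun v => ?_
      rw [← hcompl v]
      exact Set.encard_le_encard fun w hw => (G.ne_of_adj hw).symm
    · obtain ⟨u, hu⟩ := hU
      rw [← hcompl u]
      refine le_trans (Set.encard_le_encard fun w hw => ?_)
        (le_iSup (fun v => (G.neighborSet v).encard) u)
      exact huniv u hu w (Ne.symm hw)
  have hle : U.card ≤ B.card := Finset.card_le_card hUB
  have hU0 : 0 < U.card := hU.card_pos
  set X := G.edgeFinset.filter fun e => ∃ u ∈ U, u ∈ e with hX
  set Y := G.edgeFinset.filter fun e => (∃ u ∈ U, u ∈ e) ∨ ∀ v ∈ e, v ∈ B with hY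
  obtain ⟨c₀, hc₀⟩ := exists_isProperOn_incident G U hU (by omega)
  rw [← hX] at hc₀
  obtain ⟨c₁, hc₁⟩ : ∃ c, IsProperOn Y (Fintype.card V - 1) c := by
    refine hc₀.exists_extension
      (Finset.monotone_filter_right _ fun e _ he => Or.inl he) fun a b hab hab' => ?_
    have hab'' : (a ∉ U ∧ b ∉ U) := by
      simp only [hX, Finset.mem_filter, not_and, not_exists] at hab'
      have := hab' (Finset.mem_filter.1 hab).1
      exact ⟨fun h => this a h (by simp), fun h => this b h (by simp)⟩
    -- An edge of `Y` at a vertex outside `U` has its other end in `B`, so the two ends together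
    -- have degree at most 2|B| ≤ |V| in `Y`.
    have hbound : ∀ v, v ∉ U → (Y.filter (v ∈ ·)).card ≤ B.card := by
      intro v hv
      refine (card_filter_mem_edgeFinset G (· ∈ B) v Y (Finset.filter_subset _ _) ?_).trans
        (Finset.card_le_card fun w hw => (Finset.mem_filter.1 hw).2)
      intro w hw
      rcases (Finset.mem_filter.1 hw).2 with ⟨u, hu, huv⟩ | h
      · rcases Sym2.mem_iff.1 huv with rfl | rfl
        · exact absurd hu hv
        · exact hUB hu
      · exact h w (by simp)
    have := hbound a hab''.1
    have := hbound b hab''.2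
    omega
  obtain ⟨c, hc⟩ : ∃ c, IsProperOn G.edgeFinset (Fintype.card V - 1) c := by
    refine hc₁.exists_extension (Finset.filter_subset _ _) fun a b hab hab' => ?_
    have hbound : ∀ v, (G.edgeFinset.filter (v ∈ ·)).card ≤ G.degree v := fun v =>
      (card_filter_mem_edgeFinset G (fun _ => True) v _ subset_rfl fun _ _ => trivial).trans
        (Finset.card_le_card (Finset.filter_subset _ _))
    have h : ¬((∃ u ∈ U, u ∈ s(a, b)) ∨ ∀ v ∈ s(a, b), v ∈ B) := fun h =>
      hab' (Finset.mem_filter.2 ⟨hab, h⟩)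
    rw [not_or] at h
    have := hdeg a b (by simpa using hab) (fun ha => h.1 ⟨a, ha, by simp⟩)
      (fun hb => h.1 ⟨b, hb, by simp⟩) fun hab => h.2 (by simpa using hab)
    have := hbound a
    have := hbound b
    omega
  apply le_antisymm
  · rw [hmax]
    apply SimpleGraph.Colorable.chromaticNumber_le
    refine ⟨SimpleGraph.Coloring.mk
      (fun e => ⟨c e.1, hc.1 e.1 (SimpleGraph.mem_edgeFinset.2 e.2)⟩) ?_⟩
    intro e f hef
    obtain ⟨hne, v, hve, hvf⟩ := SimpleGraph.lineGraph_adj_iff_exists.1 hef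
    simpa using hc.2 v e.1 (SimpleGraph.mem_edgeFinset.2 e.2) f.1
      (SimpleGraph.mem_edgeFinset.2 f.2) hve hvf (fun h => hne (Subtype.ext h))
  · exact iSup_le fun v => encard_neighborSet_le_edgeChromaticNumber G v

/-! ### Essential annihilators and full supports -/

/-- The annihilator of a nilpotent ideal is essential. -/
theorem isEssential_annihilator_of_isNilpotent {A : Type*} [CommRing A] [Nontrivial A]
    {K : Ideal A} (hK : IsNilpotent K) : IsEssential (Submodule.annihilator K) := by
  classical
  have key : ∀ J : Ideal A, J ≠ ⊥ → Submodule.annihilator K ⊓ J ≠ ⊥ := by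
    intro J hJ h
    have hex : ∃ m, K ^ m * J = ⊥ := by
      obtain ⟨m, hm⟩ := hK
      exact ⟨m, by rw [hm, zero_mul]; rfl⟩
    -- With m + 1 the least exponent such that K^(m+1) J = 0, the ideal K^m J is nonzero, lies in J
    -- and is killed by K.
    obtain ⟨m, hm⟩ : ∃ m, Nat.find hex = m + 1 := by
      refine Nat.exists_eq_succ_of_ne_zero fun h0 => hJ ?_
      simpa [h0] using Nat.find_spec hex
    have h1 : K ^ m * J ≠ ⊥ := Nat.find_min hex (by omega)
    have h2 : K ^ (m + 1) * J = ⊥ := hm ▸ Nat.find_spec hex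
    apply h1
    rw [eq_bot_iff, ← h]
    refine le_inf ?_ Ideal.mul_le_right
    rw [Submodule.le_annihilator_iff, smul_eq_mul, mul_right_comm, ← pow_succ, h2]
  refine ⟨fun h => ?_, key⟩
  exact key ⊤ top_ne_bot (by rw [h, bot_inf_eq])

section Pi

variable {ι : Type*} [DecidableEq ι] {R : ι → Type*} [∀ i, CommRing (R i)]

theorem single_one_mem_of_isUnit {I : Ideal (∀ i, R i)} {x : ∀ i, R i} (hx : x ∈ I) {i : ι}
    (hi : IsUnit (x i)) : (Pi.single i 1 : ∀ i, R i) ∈ I := by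
  obtain ⟨y, hy⟩ := hi.exists_left_inv
  have : (Pi.single i 1 : ∀ i, R i) = Pi.single i y * x := by
    rw [← Pi.single_mul_left, hy]
  rw [this]
  exact I.mul_mem_left _ hx

variable [Fintype ι]

open Classical in
/-- The set of indices of those components of an ideal of a product ring that are the whole
ring. -/
noncomputable def fullSupport (I : Ideal (∀ i, R i)) : Finset ι :=
  Finset.univ.filter fun i => Pi.single i 1 ∈ I

theorem mem_fullSupport {I : Ideal (∀ i, R i)} {i : ι} :
    i ∈ fullSupport I ↔ Pi.single i 1 ∈ I := by
  simp [fullSupport]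

theorem mem_fullSupport_iff_piOrderIso {I : Ideal (∀ i, R i)} {i : ι} :
    i ∈ fullSupport I ↔ Ideal.piOrderIso I i = ⊤ := by
  rw [mem_fullSupport, Ideal.eq_top_iff_one]
  change _ ↔ 1 ∈ I.map (Pi.evalRingHom R i)
  rw [Ideal.mem_map_iff_of_surjective _ (Function.surjective_eval _)]
  constructor
  · exact fun h => ⟨_, h, by simp⟩
  · rintro ⟨x, hx, hxi⟩
    refine single_one_mem_of_isUnit hx ?_
    simp only [Pi.evalRingHom_apply] at hxi
    rw [hxi]
    exact isUnit_one

theorem fullSupport_mul (I J : Ideal (∀ i, R i)) :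
    fullSupport (I * J) = fullSupport I ∩ fullSupport J := by
  ext i
  simp only [Finset.mem_inter, mem_fullSupport]
  constructor
  · exact fun h => ⟨Ideal.mul_le_left h, Ideal.mul_le_right h⟩
  · rintro ⟨h1, h2⟩
    have := Ideal.mul_mem_mul h1 h2
    rwa [← Pi.single_mul, one_mul] at this

/-- The idempotent at i lies in K, so the annihilator of K meets the ideal it generates only in 0.
-/
theorem not_isEssential_of_mem_fullSupport [∀ i, Nontrivial (R i)] {K : Ideal (∀ i, R i)} {i : ι}
    (hi : i ∈ fullSupport K) : ¬ IsEssential (Submodule.annihilator K) := by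
  rintro ⟨-, h⟩
  refine h (Ideal.span {Pi.single i 1}) ?_ ?_
  · simp
  · rw [eq_bot_iff]
    rintro x ⟨hx1, hx2⟩
    obtain ⟨y, rfl⟩ := Ideal.mem_span_singleton'.1 hx2
    have := Submodule.mem_annihilator.1 hx1 _ (mem_fullSupport.1 hi)
    rw [smul_eq_mul, mul_assoc, ← Pi.single_mul, one_mul] at this
    simpa using this

theorem fullSupport_eq_univ_iff {I : Ideal (∀ i, R i)} : fullSupport I = Finset.univ ↔ I = ⊤ := by
  simp only [Finset.eq_univ_iff_forall, mem_fullSupport_iff_piOrderIso]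
  rw [← map_eq_top_iff Ideal.piOrderIso, funext_iff]
  rfl

variable [∀ i, IsLocalRing (R i)] [∀ i, IsArtinianRing (R i)]

/-- All coordinates of elements of K are non-units, so K lies in the Jacobson radical, which is
nilpotent in an Artinian ring. -/
theorem isNilpotent_of_fullSupport_eq_empty {K : Ideal (∀ i, R i)} (hK : fullSupport K = ∅) :
    IsNilpotent K := by
  have hle : K ≤ Ideal.jacobson ⊥ := by
    intro x hx
    rw [Ideal.mem_jacobson_bot]
    intro y
    rw [Pi.isUnit_iff]
    intro i
    have hxi : x i ∈ IsLocalRing.maximalIdeal (R i) := fun hu => by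
      have := mem_fullSupport.2 (single_one_mem_of_isUnit hx hu)
      simp [hK] at this
    by_contra hu
    have h1 : x i * y i + 1 ∈ IsLocalRing.maximalIdeal (R i) := hu
    have h2 := (Ideal.add_mem_iff_right _ (Ideal.mul_mem_right (y i) _ hxi)).1 h1
    exact (Ideal.ne_top_iff_one _).1 (IsLocalRing.maximalIdeal.isMaximal (R i)).ne_top h2
  obtain ⟨m, hm⟩ := IsArtinianRing.isNilpotent_jacobson_bot (R := ∀ i, R i)
  refine ⟨m, ?_⟩
  rw [Ideal.zero_eq_bot, eq_bot_iff] at hm ⊢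
  exact (Ideal.pow_right_mono hle m).trans hm

theorem isEssential_annihilator_iff [Nonempty ι] {K : Ideal (∀ i, R i)} :
    IsEssential (Submodule.annihilator K) ↔ fullSupport K = ∅ := by
  have : Nontrivial (∀ i, R i) := Pi.nontrivial_at (Classical.arbitrary ι)
  refine ⟨fun h => ?_, fun h =>
    isEssential_annihilator_of_isNilpotent (isNilpotent_of_fullSupport_eq_empty h)⟩
  by_contra hne
  obtain ⟨i, hi⟩ := Finset.nonempty_iff_ne_empty.2 hne
  exact not_isEssential_of_mem_fullSupport hi h

theorem annihilator_ne_bot_iff {I : Ideal (∀ i, R i)} :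
    Submodule.annihilator I ≠ ⊥ ↔ I ≠ ⊤ := by
  constructor
  · rintro h rfl
    apply h
    rw [eq_bot_iff]
    intro x hx
    simpa using Submodule.mem_annihilator.1 hx 1 trivial
  · intro h h0
    rw [← fullSupport_eq_univ_iff.ne, ne_eq, Finset.eq_univ_iff_forall, not_forall] at h
    obtain ⟨i, hi⟩ := h
    have : Nonempty ι := ⟨i⟩
    -- If component i of I is proper, I * E is nilpotent, so its annihilator meets E. An element of
    -- that intersection is a multiple of the idempotent at i and hence kills I itself.
    set E : Ideal (∀ i, R i) := Ideal.span {Pi.single i 1} with hE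
    have hEs : fullSupport E ⊆ {i} := by
      intro j hj
      rw [mem_fullSupport, hE, Ideal.mem_span_singleton'] at hj
      obtain ⟨y, hy⟩ := hj
      by_contra hji
      have hji : j ≠ i := by simpa using hji
      have := congrFun hy j
      simp [Pi.single_eq_of_ne hji] at this
    have hIE : fullSupport (I * E) = ∅ := by
      rw [fullSupport_mul, ← Finset.disjoint_iff_inter_eq_empty]
      exact Finset.disjoint_of_subset_right hEs (by simpa using hi)
    refine (isEssential_annihilator_iff.2 hIE).2 E (by simp [hE]) ?_
    rw [eq_bot_iff, ← h0]
    rintro x ⟨hx1, hx2⟩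
    obtain ⟨y, rfl⟩ := Ideal.mem_span_singleton'.1 hx2
    refine Submodule.mem_annihilator.2 fun z hz => ?_
    have := Submodule.mem_annihilator.1 hx1 _
      (Ideal.mul_mem_mul hz (Ideal.mem_span_singleton_self (Pi.single i (1 : R i))))
    have hid : (Pi.single i 1 : ∀ i, R i) * Pi.single i 1 = Pi.single i 1 := by
      rw [← Pi.single_mul, one_mul]
    rw [smul_eq_mul] at this ⊢
    rw [← this]
    nth_rewrite 1 [← hid]
    ring

theorem essAnnGraph_adj_iff [Nonempty ι] {I J : Vertex (∀ i, R i)} :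
    (essAnnGraph (∀ i, R i)).Adj I J ↔
      I ≠ J ∧ Disjoint (fullSupport I.1) (fullSupport J.1) := by
  change _ ∧ IsEssential _ ↔ _
  rw [isEssential_annihilator_iff, fullSupport_mul, Finset.disjoint_iff_inter_eq_empty]

end Pi

/-! ### Counting ideals, vertices and degrees -/

section Count

variable {ι : Type*} [Fintype ι] [DecidableEq ι] {R : ι → Type*} [∀ i, CommRing (R i)]
  [∀ i, Fintype (Ideal (R i))] [Fintype (Ideal (∀ i, R i))] {t : ℕ}

theorem card_ideal_pi (hR : ∀ i, Fintype.card (Ideal (R i)) = t + 1) :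
    Fintype.card (Ideal (∀ i, R i)) = (t + 1) ^ Fintype.card ι := by
  rw [Fintype.card_congr Ideal.piOrderIso.toEquiv, Fintype.card_pi]
  simp [hR]

/-- The number of ideals of a product ring whose components at the indices in `S` are proper. -/
theorem card_disjoint_fullSupport (hR : ∀ i, Fintype.card (Ideal (R i)) = t + 1) (S : Finset ι) :
    (Finset.univ.filter fun I : Ideal (∀ i, R i) => Disjoint (fullSupport I) S).card =
      t ^ S.card * (t + 1) ^ (Fintype.card ι - S.card) := by
  classical
  have h1 : (Finset.univ.filter fun I : Ideal (∀ i, R i) => Disjoint (fullSupport I) S).card =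
      (Fintype.piFinset fun i => if i ∈ S then (Finset.univ : Finset (Ideal (R i))).erase ⊤
        else Finset.univ).card := by
    refine Finset.card_equiv Ideal.piOrderIso.toEquiv fun I => ?_
    simp only [Finset.mem_filter, Finset.mem_univ, true_and, Fintype.mem_piFinset,
      Finset.disjoint_right, mem_fullSupport_iff_piOrderIso]
    refine forall_congr' fun i => ?_
    by_cases hi : i ∈ S <;> simp [hi]
  rw [h1, Fintype.card_piFinset]
  have h2 : ∀ i, (if i ∈ S then (Finset.univ : Finset (Ideal (R i))).erase ⊤
      else Finset.univ).card = if i ∈ S then t else t + 1 := by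
    intro i
    split_ifs
    · rw [Finset.card_erase_of_mem (Finset.mem_univ _), Finset.card_univ, hR, Nat.add_sub_cancel]
    · rw [Finset.card_univ, hR]
  simp_rw [h2]
  rw [Finset.prod_ite, Finset.prod_const, Finset.prod_const, Finset.filter_mem_eq_inter,
    Finset.univ_inter, Finset.filter_not, Finset.filter_mem_eq_inter, Finset.univ_inter,
    ← Finset.compl_eq_univ_sdiff, Finset.card_compl]

/-- Few ideals of a product ring have few full components. -/
theorem card_fullSupport_lt (hR : ∀ i, Fintype.card (Ideal (R i)) = t + 1) (k : ℕ) :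
    (Finset.univ.filter fun I : Ideal (∀ i, R i) => (fullSupport I).card < k).card *
      2 ^ Fintype.card ι ≤ 2 ^ k * (2 * t + 1) ^ Fintype.card ι := by
  classical
  -- Markov-type bound: give each ideal weight 2 per proper component and 1 per full one. The total
  -- weight is (2t+1)^n, while an ideal with fewer than k full components has weight at least
  -- 2^(n-k).
  have hprod : ∀ I : Ideal (∀ i, R i),
      (∏ i, if Ideal.piOrderIso I i = ⊤ then 1 else 2) =
        2 ^ (Fintype.card ι - (fullSupport I).card) := by
    intro I
    simp_rw [← mem_fullSupport_iff_piOrderIso]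
    rw [Finset.prod_ite, Finset.prod_const, Finset.prod_const, one_pow, one_mul,
      Finset.filter_not, Finset.filter_mem_eq_inter, Finset.univ_inter,
      ← Finset.compl_eq_univ_sdiff, Finset.card_compl]
  have hsum : ∀ i, (∑ J : Ideal (R i), if J = ⊤ then 1 else 2) = 2 * t + 1 := by
    intro i
    rw [← Finset.add_sum_erase _ _ (Finset.mem_univ (⊤ : Ideal (R i))),
      Finset.sum_congr rfl fun J hJ => if_neg (Finset.ne_of_mem_erase hJ), Finset.sum_const,
      Finset.card_erase_of_mem (Finset.mem_univ _), Finset.card_univ, hR]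
    simp
    ring
  calc _ = ∑ I : Ideal (∀ i, R i) with (fullSupport I).card < k, 2 ^ Fintype.card ι := by
        rw [Finset.sum_const, smul_eq_mul]
    _ ≤ ∑ I : Ideal (∀ i, R i) with (fullSupport I).card < k,
          2 ^ k * ∏ i, (if Ideal.piOrderIso I i = ⊤ then 1 else 2) := by
        refine Finset.sum_le_sum fun I hI => ?_
        rw [hprod, ← pow_add]
        have := (Finset.mem_filter.1 hI).2
        exact Nat.pow_le_pow_right (by norm_num) (by omega)
    _ ≤ ∑ I : Ideal (∀ i, R i),
          2 ^ k * ∏ i, (if Ideal.piOrderIso I i = ⊤ then 1 else 2) :=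
        Finset.sum_le_sum_of_subset (Finset.filter_subset _ _)
    _ = 2 ^ k * ∑ f : ∀ i, Ideal (R i), ∏ i, (if f i = ⊤ then 1 else 2) := by
        rw [← Finset.mul_sum]
        congr 1
        exact Fintype.sum_equiv Ideal.piOrderIso.toEquiv _ _ fun _ => rfl
    _ = 2 ^ k * (2 * t + 1) ^ Fintype.card ι := by
        rw [← Fintype.prod_sum fun (i : ι) (J : Ideal (R i)) => if J = ⊤ then 1 else 2]
        simp_rw [hsum]
        simp

variable [∀ i, IsLocalRing (R i)] [∀ i, IsArtinianRing (R i)] [Nonempty ι]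

theorem card_vertex (hR : ∀ i, Fintype.card (Ideal (R i)) = t + 1)
    [Fintype (Vertex (∀ i, R i))] :
    Fintype.card (Vertex (∀ i, R i)) + 2 = (t + 1) ^ Fintype.card ι := by
  classical
  have : Nontrivial (∀ i, R i) := Pi.nontrivial_at (Classical.arbitrary ι)
  have h : Fintype.card (Vertex (∀ i, R i)) =
      ({⊥, ⊤}ᶜ : Finset (Ideal (∀ i, R i))).card := by
    apply Fintype.card_of_subtype
    intro I
    simp [annihilator_ne_bot_iff]
  have h2 : ({⊥, ⊤} : Finset (Ideal (∀ i, R i))).card = 2 := Finset.card_pair bot_ne_top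
  rw [← card_ideal_pi hR, h, ← h2, Finset.card_compl_add_card]

open Classical in
theorem degree_add_one_le (hR : ∀ i, Fintype.card (Ideal (R i)) = t + 1)
    [Fintype (Vertex (∀ i, R i))] (v : Vertex (∀ i, R i)) :
    (essAnnGraph (∀ i, R i)).degree v + 1 ≤ t ^ (fullSupport v.1).card *
      (t + 1) ^ (Fintype.card ι - (fullSupport v.1).card) := by
  rw [← card_disjoint_fullSupport hR]
  set F := Finset.univ.filter fun I : Ideal (∀ i, R i) =>
    Disjoint (fullSupport I) (fullSupport v.1) with hF
  -- The zero ideal is counted in `F` but is not a vertex; this gives the + 1.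
  have hbot : ⊥ ∈ F := by
    have : fullSupport (⊥ : Ideal (∀ i, R i)) = ∅ := by
      ext i
      simp [mem_fullSupport]
    simp [hF, this]
  rw [← Finset.card_erase_add_one hbot, Nat.add_le_add_iff_right,
    ← SimpleGraph.card_neighborFinset_eq_degree,
    ← Finset.card_image_of_injective _ Subtype.val_injective]
  refine Finset.card_le_card fun I hI => ?_
  obtain ⟨w, hw, rfl⟩ := Finset.mem_image.1 hI
  rw [SimpleGraph.mem_neighborFinset, essAnnGraph_adj_iff] at hw
  simp [hF, w.2.1, hw.2.symm]

end Count

/-! ### Choice of the constants and conclusion -/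

theorem card_ideal_of_card_proper {A : Type*} [CommRing A] {t : ℕ} (ht : t ≠ 0)
    (h : Nat.card {I : Ideal A // I ≠ ⊤} = t) : Nat.card (Ideal A) = t + 1 := by
  classical
  have : Finite {I : Ideal A // I ≠ ⊤} := Nat.finite_of_card_ne_zero (h ▸ ht)
  rw [← Nat.card_congr (Equiv.optionSubtypeNe (⊤ : Ideal A)), Finite.card_option, h]

theorem exists_forall_mul_pow_le {a b : ℕ} (ha : 0 < a) (hab : a < b) (C : ℕ) :
    ∃ N, ∀ n, N ≤ n → C * a ^ n ≤ b ^ n := by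
  have h1 : (1 : ℝ) < b / a := by
    rw [one_lt_div (by exact_mod_cast ha)]
    exact_mod_cast hab
  obtain ⟨N, hN⟩ := Filter.eventually_atTop.1
    ((tendsto_pow_atTop_atTop_of_one_lt h1).eventually_ge_atTop (C : ℝ))
  refine ⟨N, fun n hn => ?_⟩
  have := hN n hn
  rw [div_pow, le_div_iff₀ (by positivity)] at this
  exact_mod_cast this

/-- For every `t ≥ 2`, the graph of a product of sufficiently many Artinian local rings with
exactly `t` proper ideals each is Class 1. -/
theorem exists_forall_isClassOne_essAnnGraph_pi (t : ℕ) (ht : 2 ≤ t) :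
    ∃ N : ℕ, ∀ n : ℕ, N ≤ n → 2 ≤ n →
      ∀ (R : Fin n → Type*) [∀ i, CommRing (R i)] [∀ i, IsLocalRing (R i)]
        [∀ i, IsArtinianRing (R i)],
        (∀ i, Nat.card {I : Ideal (R i) // I ≠ ⊤} = t) →
          IsClassOne (essAnnGraph (∀ i, R i)) := by
  classical
  -- From k full components on, degree + 1 is at most (t+1)^(n-1).
  obtain ⟨k, hk⟩ := exists_forall_mul_pow_le (by omega : 0 < t) t.lt_succ_self (t + 1)
  -- The bound on |B| has the factor 2^(k+1); the further factor 4 yields 2|B| + 2 ≤ (t+1)^n = |V| +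
  -- 2.
  obtain ⟨N, hN⟩ := exists_forall_mul_pow_le (by omega : 0 < 2 * t + 1)
    (by omega : 2 * t + 1 < 2 * (t + 1)) (2 ^ (k + 3))
  refine ⟨N, fun n hn hn2 R _ _ _ hR => ?_⟩
  have : Nonempty (Fin n) := ⟨⟨0, by omega⟩⟩
  have hcard : ∀ i, Nat.card (Ideal (R i)) = t + 1 := fun i =>
    card_ideal_of_card_proper (by omega) (hR i)
  have hfin : ∀ i, Finite (Ideal (R i)) := fun i =>
    Nat.finite_of_card_ne_zero (by rw [hcard i]; omega)
  have hfin' : Finite (Ideal (∀ i, R i)) := Finite.of_equiv _ Ideal.piOrderIso.toEquiv.symm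
  let _ : ∀ i, Fintype (Ideal (R i)) := fun i => Fintype.ofFinite _
  let _ : Fintype (Ideal (∀ i, R i)) := Fintype.ofFinite _
  let _ : Fintype (Vertex (∀ i, R i)) := Fintype.ofFinite _
  replace hcard : ∀ i, Fintype.card (Ideal (R i)) = t + 1 := fun i => by
    rw [← Nat.card_eq_fintype_card, hcard i]
  have hV := card_vertex hcard
  have hd := degree_add_one_le hcard
  have hB := card_fullSupport_lt hcard (k + 1)
  rw [Fintype.card_fin] at hV hB
  simp only [Fintype.card_fin] at hd
  have hsupp : ∀ v : Vertex (∀ i, R i), (fullSupport v.1).card ≤ n := fun v => by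
    simpa using Finset.card_le_univ (fullSupport v.1)
  have hpos : ∀ v : Vertex (∀ i, R i), 1 ≤ (fullSupport v.1).card →
      (t + 1) * ((essAnnGraph (∀ i, R i)).degree v + 1) ≤ t * (t + 1) ^ n := by
    intro v hv
    obtain ⟨s, hs⟩ := Nat.exists_eq_add_of_le' hv
    have h1 := hd v
    have h2 := hsupp v
    rw [hs] at h1 h2
    calc _ ≤ (t + 1) * (t ^ (s + 1) * (t + 1) ^ (n - (s + 1))) := Nat.mul_le_mul_left _ h1
      _ = t * (t ^ s * (t + 1) ^ (n - (s + 1) + 1)) := by ring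
      _ ≤ t * ((t + 1) ^ s * (t + 1) ^ (n - (s + 1) + 1)) := by gcongr; omega
      _ = t * (t + 1) ^ n := by rw [← pow_add]; congr 2; omega
  have hlarge : ∀ v : Vertex (∀ i, R i), k ≤ (fullSupport v.1).card →
      (t + 1) * ((essAnnGraph (∀ i, R i)).degree v + 1) ≤ (t + 1) ^ n := by
    intro v hv
    calc _ ≤ (t + 1) * (t ^ (fullSupport v.1).card * (t + 1) ^ (n - (fullSupport v.1).card)) :=
          Nat.mul_le_mul_left _ (hd v)
      _ = ((t + 1) * t ^ (fullSupport v.1).card) * (t + 1) ^ (n - (fullSupport v.1).card) := by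
          ring
      _ ≤ (t + 1) ^ (fullSupport v.1).card * (t + 1) ^ (n - (fullSupport v.1).card) :=
          Nat.mul_le_mul_right _ (hk _ hv)
      _ = (t + 1) ^ n := by rw [← pow_add, Nat.add_sub_cancel' (hsupp v)]
  refine isClassOne_of_universal _ (Finset.univ.filter fun v => fullSupport v.1 = ∅)
    (Finset.univ.filter fun v => (fullSupport v.1).card < k + 1) ?_ ?_ ?_ ?_ ?_
  · exact Finset.monotone_filter_right _ fun v _ hv => by simp [hv]
  · have h1 := card_disjoint_fullSupport hcard Finset.univ
    -- There are t^n > 1 ideals with all components proper, so one of them is nonzero.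
    obtain ⟨I, hI, hI0⟩ := Finset.exists_mem_ne (s := Finset.univ.filter fun I : Ideal (∀ i, R i) =>
      Disjoint (fullSupport I) Finset.univ) (by
        rw [h1, Finset.card_univ, Nat.sub_self, pow_zero, mul_one, Fintype.card_fin]
        exact Nat.one_lt_pow (by omega) (by omega)) ⊥
    have hI' : fullSupport I = ∅ := by
      rw [← Finset.inter_univ (fullSupport I)]
      exact Finset.disjoint_iff_inter_eq_empty.1 (Finset.mem_filter.1 hI).2
    refine ⟨⟨I, hI0, annihilator_ne_bot_iff.2 fun htop => ?_⟩, by simpa using hI'⟩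
    rw [← fullSupport_eq_univ_iff, hI'] at htop
    exact Finset.univ_nonempty.ne_empty htop.symm
  · intro u hu v huv
    rw [essAnnGraph_adj_iff]
    exact ⟨huv, by simp [(Finset.mem_filter.1 hu).2]⟩
  · set b := (Finset.univ.filter fun I : Ideal (∀ i, R i) => (fullSupport I).card < k + 1).card
    have hle : (Finset.univ.filter fun v : Vertex (∀ i, R i) =>
        (fullSupport v.1).card < k + 1).card ≤ b :=
      Finset.card_le_card_of_injOn Subtype.val (fun v hv => by simpa using hv)
        Subtype.val_injective.injOn
    refine (Nat.mul_le_mul_left 2 hle).trans ?_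
    have h1 := hN n hn
    rw [mul_pow] at h1
    have h2 : 2 ^ n ≤ 2 ^ (k + 1) * (2 * t + 1) ^ n :=
      (Nat.pow_le_pow_left (by omega) n).trans (Nat.le_mul_of_pos_left _ (by positivity))
    have h3 : 2 ^ n * (2 * b + 2) ≤ 2 ^ n * (t + 1) ^ n := by
      refine le_trans ?_ h1
      have : 2 ^ (k + 3) * (2 * t + 1) ^ n = 4 * (2 ^ (k + 1) * (2 * t + 1) ^ n) := by ring
      rw [this]
      linarith
    have := Nat.le_of_mul_le_mul_left h3 (by positivity)
    omega
  · intro a b _ ha hb hab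
    have hpos' : ∀ {v : Vertex (∀ i, R i)},
        v ∉ (Finset.univ.filter fun v : Vertex (∀ i, R i) => fullSupport v.1 = ∅) →
        1 ≤ (fullSupport v.1).card := by
      intro v hv
      exact Finset.card_pos.2 (Finset.nonempty_iff_ne_empty.2 (by simpa using hv))
    have h1 := hpos a (hpos' ha)
    have h2 := hpos b (hpos' hb)
    -- One end has at least k full components, the other at least one, and t(t+1)^(n-1) +
    -- (t+1)^(n-1) = |V| + 2.
    have h3 : (t + 1) * ((essAnnGraph (∀ i, R i)).degree a + (essAnnGraph (∀ i, R i)).degree b + 2)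
        ≤ (t + 1) * (t + 1) ^ n := by
      by_cases hka : k ≤ (fullSupport a.1).card
      · have := hlarge a hka
        linarith
      · have hkb : k ≤ (fullSupport b.1).card := by
          by_contra hkb
          exact hab ⟨by simp; omega, by simp; omega⟩
        have := hlarge b hkb
        linarith
    have := Nat.le_of_mul_le_mul_left h3 (by omega)
    omega

end EssentialAnnihilatingIdealGraph

theorem theorem2p16 (t : ℕ) (ht : 2 ≤ t) (heven : Even t) :
    ∃ N : ℕ, ∀ n : ℕ, N ≤ n → 2 ≤ n →
      ∀ (R : Fin n → Type*) [∀ i, CommRing (R i)] [∀ i, IsLocalRing (R i)]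
        [∀ i, IsArtinianRing (R i)],
        (∀ i, Nat.card {I : Ideal (R i) // I ≠ ⊤} = t) →
          EssentialAnnihilatingIdealGraph.IsClassOne
            (EssentialAnnihilatingIdealGraph.essAnnGraph (∀ i, R i)) :=
  EssentialAnnihilatingIdealGraph.exists_forall_isClassOne_essAnnGraph_pi t ht
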